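/- Let $f(\ell,x)>0$ ($\ell,x\in\mathbb{Z}_+$) be non-decreasing in $\ell$ for each $x$. Let $\mathbf{X}=(X_n)_{n\ge 0}$ be the edge-reinforced random walk on $\mathbb{Z}_+$ with reinforcement scheme $f$, that is, the nearest-neighbour process with $$\mathbb{P}(X_{n+1}=X_n+1\mid X_0,\dots,X_n)=1-\mathbb{P}(X_{n+1}=X_n-1\mid X_0,\dots,X_n)=\frac{w_n(X_n)}{w_n(X_n-1)+w_n(X_n)},$$ where $w_n(x)=f(\phi_n(x),x)$ for $x\in\mathbb{Z}_+$, $w_n(-1)=0$, and $\phi_n(x)$ is the number of $i\in\{1,\dots,n\}$ with $\{X_{i-1},X_i\}=\{x,x+1\}$; the law of $X_0$ is arbitrary. Suppose that the reinforcement is of factor type, i.e. $f(\ell,x)=\delta_\ell\, f(0,x)$ for all $\ell,x\in\mathbb{Z}_+$, where $(\delta_\ell)_{\ell\ge 0}$ is a positive non-decreasing sequence with $\delta_0=1$, and that there is a constant $C\in(0,\infty)$ such that $$\frac{f(0,x)}{f(0,x-1)}\le C\qquad\text{for all integers } x\ge 1.$$ If $\sum_{\ell=0}^\infty \delta_\ell^{-1}<\infty$,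 then $\mathbf{X}$ localizes on a single edge almost surely: with probability one there is $x\in\mathbb{Z}_+$ such that the set of vertices visited infinitely often by $\mathbf{X}$ is exactly $\{x,x+1\}$. (In particular, no assumption is made on whether $\sum_{x} f(0,x)^{-1}$ is finite or infinite, so the initially transient case $\sum_x f(0,x)^{-1}<\infty$ is included.) -/

import Mathlib

open MeasureTheory ProbabilityTheory Filter

namespace ERRW

/-- `φ_n(x)`: the number of traversals of the non-oriented edge `{x, x+1}` by the path `p`
up to time `n`. -/
def traversals (p : ℕ → ℕ) (n x : ℕ) : ℕ :=
  ((Finset.range n).filter fun i => s(p i, p (i + 1)) = s(x, x + 1)).card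

/-- `w_n(x) = f(φ_n(x), x)`: the weight of the edge `{x, x+1}` at time `n`. -/
def weight (f : ℕ → ℕ → ℝ) (p : ℕ → ℕ) (n x : ℕ) : ℝ :=
  f (traversals p n x) x

/-- `w_n(x - 1)`: the weight at time `n` of the edge to the left of the vertex `x`,
with the convention `w_n(-1) = 0` (reflection at the origin). -/
def leftWeight (f : ℕ → ℕ → ℝ) (p : ℕ → ℕ) (n : ℕ) : ℕ → ℝ
  | 0 => 0
  | x + 1 => weight f p n x

/-- The probability `w_n(x) / (w_n(x - 1) + w_n(x))`, `x = p n`, of a step to the right at time `n`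
for a walk that has followed the path `p` up to time `n`. -/
noncomputable def rightProb (f : ℕ → ℕ → ℝ) (p : ℕ → ℕ) (n : ℕ) : ℝ :=
  weight f p n (p n) / (leftWeight f p n (p n) + weight f p n (p n))

/-- For every vertex `x`, `ℓ ↦ f(ℓ, x)` is a non-decreasing sequence of positive numbers. -/
structure IsReinforcementScheme (f : ℕ → ℕ → ℝ) : Prop where
  pos : ∀ ℓ x, 0 < f ℓ x
  mono : ∀ x, Monotone fun ℓ => f ℓ x

/-- Factor type reinforcement: `f(ℓ, x) = δ_ℓ f(0, x)` with `δ` positive, non-decreasing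
and `δ_0 = 1`. -/
structure IsFTR (f : ℕ → ℕ → ℝ) (δ : ℕ → ℝ) : Prop where
  pos : ∀ ℓ, 0 < δ ℓ
  mono : Monotone δ
  zero : δ 0 = 1
  factor : ∀ ℓ x, f ℓ x = δ ℓ * f 0 x

/-- The event that the process follows the path `p` up to time `n`. -/
def history {Ω : Type*} (X : ℕ → Ω → ℕ) (p : ℕ → ℕ) (n : ℕ) : Set Ω :=
  {ω | ∀ i ≤ n, X i ω = p i}

/-- `X` is an edge-reinforced random walk on the non-negative integers with reinforcement
scheme `f`: conditionally on any history `X_0 = p 0, …, X_n = p n` of positive probability,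
it steps to the right with probability `w_n(X_n) / (w_n(X_n - 1) + w_n(X_n))` and to the left with
the complementary probability. The law of `X_0` is arbitrary. -/
structure IsERRW {Ω : Type*} [MeasurableSpace Ω] (μ : Measure Ω) (f : ℕ → ℕ → ℝ)
    (X : ℕ → Ω → ℕ) : Prop where
  measurable : ∀ n, Measurable (X n)
  step_right : ∀ (p : ℕ → ℕ) (n : ℕ), μ (history X p n) ≠ 0 →
    (μ[|history X p n]).real {ω | X (n + 1) ω = p n + 1} = rightProb f p n
  step_left : ∀ (p : ℕ → ℕ) (n : ℕ), μ (history X p n) ≠ 0 →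
    (μ[|history X p n]).real {ω | X (n + 1) ω + 1 = p n} = 1 - rightProb f p n

/-- The set of vertices that the path `p` visits infinitely often. -/
def visitedInfinitelyOften (p : ℕ → ℕ) : Set ℕ :=
  {v | ∃ᶠ n in atTop, p n = v}

/-- The path `p` localizes on a single edge: the vertices it visits infinitely often are exactly
the two endpoints of one edge. -/
def LocalizesOnSingleEdge (p : ℕ → ℕ) : Prop :=
  ∃ x, visitedInfinitelyOften p = {x, x + 1}

end ERRW

/-! Localization follows from two almost sure facts.

Bounded range (`IsERRW.ae_exists_traversals_eq_zero`). At `x + 1`, with `{x, x + 1}` crossed `m`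
times and `{x + 1, x + 2}` still fresh, the factor form and the ratio bound give `f 0 (x + 1) ≤ C *
f m x / δ m`, so the step goes left with probability at least `1 / (1 + C / δ m)`. The product over
`m` is at least `exp (-C * ∑ 1 / δ k) > 0`, uniformly in `x`. Hence every further edge to the right
is reached with conditional probability bounded away from one, whether or not the initial weights
make the walk transient.

No two adjacent edges are both crossed infinitely often (`IsERRW.ae_not_frequently_adjacent`). In
Rubin's picture, departures from `x + 1` are driven by independent exponential clocks whose rates
are the successive weights. The total times `L` and `R` of the two sides are finite because the
reciprocal weights are summable, and both edges can be used forever only if `L = R`, which has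
probability zero. The proof replaces the clocks by a bounded complex martingale started from the
characteristic function of `L - R` at `t`. Letting time and then `t` tend to infinity turns it into
the indicator of the bad event, while its initial value tends to zero.

A bounded path crosses some edge infinitely often; its neighbours are then eventually unused, and
the path is trapped (`localizesOnSingleEdge_of_bounded`). -/

namespace ERRW

/-! ### Deterministic paths: traversal counts, parity and trapping -/

/-- The path `p` makes only nearest-neighbour steps up to time `n`. -/
def IsNearestNeighbour (p : ℕ → ℕ) (n : ℕ) : Prop :=
  ∀ i < n, p (i + 1) = p i + 1 ∨ p (i + 1) + 1 = p i

/-- The path that follows `p` up to time `n` and is at `v` from time `n + 1` on. -/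
def extend (p : ℕ → ℕ) (n v : ℕ) : ℕ → ℕ := fun i => if i ≤ n then p i else v

lemma extend_of_le (p : ℕ → ℕ) {n i : ℕ} (v : ℕ) (h : i ≤ n) : extend p n v i = p i := by
  simp [extend, h]

lemma extend_succ (p : ℕ → ℕ) (n v : ℕ) : extend p n v (n + 1) = v := by
  simp [extend]

lemma edge_right_iff (a x : ℕ) : s(a, a + 1) = s(x, x + 1) ↔ a = x := by
  simp only [Sym2.eq_iff]; omega

lemma edge_left_iff (a x : ℕ) : s(a + 1, a) = s(x, x + 1) ↔ a = x := by
  simp only [Sym2.eq_iff]; omega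

lemma traversals_zero (p : ℕ → ℕ) (x : ℕ) : traversals p 0 x = 0 := by
  simp [traversals]

lemma traversals_succ (p : ℕ → ℕ) (n x : ℕ) :
    traversals p (n + 1) x
      = traversals p n x + if s(p n, p (n + 1)) = s(x, x + 1) then 1 else 0 := by
  unfold traversals
  rw [Finset.range_add_one, Finset.filter_insert]
  split_ifs with h
  · rw [Finset.card_insert_of_notMem (by simp)]
  · rfl

lemma traversals_congr {p q : ℕ → ℕ} {n : ℕ} (h : ∀ i ≤ n, p i = q i) (x : ℕ) :
    traversals p n x = traversals q n x := by
  unfold traversals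
  congr 1
  refine Finset.filter_congr fun i hi => ?_
  rw [Finset.mem_range] at hi
  rw [h i (by omega), h (i + 1) (by omega)]

lemma traversals_extend (p : ℕ → ℕ) (n v x : ℕ) :
    traversals (extend p n v) (n + 1) x
      = traversals p n x + if s(p n, v) = s(x, x + 1) then 1 else 0 := by
  rw [traversals_succ, extend_succ, extend_of_le p v le_rfl,
    traversals_congr (fun i hi => extend_of_le p v hi)]

lemma traversals_extend_right (p : ℕ → ℕ) (n x : ℕ) :
    traversals (extend p n (p n + 1)) (n + 1) x
      = traversals p n x + if p n = x then 1 else 0 := by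
  simp only [traversals_extend, edge_right_iff]

lemma traversals_extend_left (p : ℕ → ℕ) (n x : ℕ) :
    traversals (extend p n (p n - 1)) (n + 1) x
      = traversals p n x + if p n = x + 1 then 1 else 0 := by
  rw [traversals_extend]
  congr 1
  refine if_congr ?_ rfl rfl
  -- At the origin `p n - 1 = 0`, and the loop `s(0, 0)` is no edge, so the formula survives
  -- truncated subtraction.
  simp only [Sym2.eq_iff]; omega

lemma traversals_mono (p : ℕ → ℕ) (x : ℕ) : Monotone fun n => traversals p n x :=
  monotone_nat_of_le_succ fun n => by simp only [traversals_succ]; omega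

lemma IsNearestNeighbour.of_succ {p : ℕ → ℕ} {n : ℕ} (h : IsNearestNeighbour p (n + 1)) :
    IsNearestNeighbour p n := fun i hi => h i (by omega)

/-- An edge has been traversed an even number of times exactly when the current position lies on
the same side of the edge as the starting point. -/
lemma traversals_mod_two {p : ℕ → ℕ} {n : ℕ} (h : IsNearestNeighbour p n) (x : ℕ) :
    traversals p n x % 2 = if (p 0 ≤ x ↔ p n ≤ x) then 0 else 1 := by
  induction n with
  | zero => simp [traversals_zero]
  | succ n ih =>
    have ih := ih h.of_succ
    rw [traversals_succ]
    rcases h n (by omega) with h1 | h1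
    · simp only [h1, edge_right_iff]
      split_ifs at ih ⊢ <;> omega
    · simp only [← h1, edge_left_iff] at ih ⊢
      split_ifs at ih ⊢ <;> omega

/-- Zero is even, so by parity the path is still on its starting side of the edge. -/
lemma le_of_traversals_eq_zero {p : ℕ → ℕ} {n x : ℕ} (h : IsNearestNeighbour p n)
    (h0 : p 0 ≤ x) (ht : traversals p n x = 0) : p n ≤ x := by
  have := traversals_mod_two h x
  rw [ht] at this
  split_ifs at this with hc
  tauto

/-- Before crossing `{x, x + 1}` the path stays at or below `x`, hence cannot touch the next edge.
-/
lemma traversals_succ_eq_zero {p : ℕ → ℕ} {n x : ℕ} (h : IsNearestNeighbour p n)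
    (h0 : p 0 ≤ x) (ht : traversals p n x = 0) : traversals p n (x + 1) = 0 := by
  induction n with
  | zero => exact traversals_zero _ _
  | succ n ih =>
    have hn : traversals p n x = 0 := by
      have := traversals_mono p x (Nat.le_succ n)
      simp only [Nat.succ_eq_add_one] at this
      omega
    have h1 := le_of_traversals_eq_zero h.of_succ h0 hn
    have h2 := le_of_traversals_eq_zero h h0 ht
    rw [traversals_succ, ih h.of_succ hn, if_neg]
    simp only [Sym2.eq_iff]; omega

/-- A bounded nearest-neighbour path that never traverses two adjacent edges infinitely often
localizes on a single edge. -/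
lemma localizesOnSingleEdge_of_bounded {p : ℕ → ℕ} (hp : ∀ n, IsNearestNeighbour p n) {b : ℕ}
    (hb : ∀ n, p n ≤ b)
    (hadj : ∀ x, ¬ ((∃ᶠ n in atTop, s(p n, p (n + 1)) = s(x, x + 1)) ∧
      ∃ᶠ n in atTop, s(p n, p (n + 1)) = s(x + 1, x + 1 + 1))) :
    LocalizesOnSingleEdge p := by
  have hstep : ∀ n, ∃ e ≤ b, s(p n, p (n + 1)) = s(e, e + 1) := by
    intro n
    rcases hp (n + 1) n (by omega) with h | h
    · exact ⟨p n, hb n, by rw [h]⟩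
    · exact ⟨p (n + 1), hb _, by rw [← h, Sym2.eq_swap]⟩
  -- Pigeonhole over the finitely many edges below the bound.
  obtain ⟨e, he⟩ : ∃ e, ∃ᶠ n in atTop, s(p n, p (n + 1)) = s(e, e + 1) := by
    by_contra hcon
    have h1 : ∀ e, ∀ᶠ n in atTop, ¬ s(p n, p (n + 1)) = s(e, e + 1) := fun e =>
      not_frequently.mp fun he => hcon ⟨e, he⟩
    have h2 : ∀ᶠ n in atTop, ∀ e ∈ Set.Iic b, ¬ s(p n, p (n + 1)) = s(e, e + 1) :=
      (eventually_all_finite (Set.finite_Iic b)).2 fun e _ => h1 e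
    obtain ⟨n, hn⟩ := h2.exists
    obtain ⟨e, he, hs⟩ := hstep n
    exact hn e he hs
  have hright : ∀ᶠ n in atTop, ¬ s(p n, p (n + 1)) = s(e + 1, e + 1 + 1) :=
    not_frequently.mp fun h => hadj e ⟨he, h⟩
  -- Quantifying over `d` makes the claim vacuous for `e = 0`, which has no left neighbour.
  have hleft : ∀ᶠ n in atTop, ∀ d, d + 1 = e → ¬ s(p n, p (n + 1)) = s(d, d + 1) := by
    rcases e with _ | d
    · exact Eventually.of_forall fun n d hd => by omega
    · have := not_frequently.mp fun h => hadj d ⟨h, he⟩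
      filter_upwards [this] with n hn d' hd'
      obtain rfl : d' = d := by omega
      exact hn
  obtain ⟨N, hN⟩ := eventually_atTop.mp (hright.and hleft)
  obtain ⟨m, hmN, hm⟩ := frequently_atTop.mp he N
  have hstay : ∀ n, m ≤ n → p n = e ∨ p n = e + 1 := by
    intro n hn
    induction n, hn using Nat.le_induction with
    | base => simp only [Sym2.eq_iff] at hm; omega
    | succ n hn ih =>
      obtain ⟨hr, hl⟩ := hN n (by omega)
      have hl' := hl (e - 1)
      simp only [Sym2.eq_iff] at hr hl'
      rcases hp (n + 1) n (by omega) with h | h <;> omega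
  have hboth : ∀ v, v = e ∨ v = e + 1 → ∃ᶠ n in atTop, p n = v := by
    intro v hv
    rw [frequently_atTop]
    intro a
    obtain ⟨n, hn, hs⟩ := frequently_atTop.mp he a
    simp only [Sym2.eq_iff] at hs
    by_cases h : p n = v
    · exact ⟨n, hn, h⟩
    · exact ⟨n + 1, by omega, by omega⟩
  refine ⟨e, Set.ext fun v => ⟨fun hv => ?_, fun hv => hboth v (by simpa using hv)⟩⟩
  obtain ⟨n, hn, hs⟩ := frequently_atTop.mp hv m
  have := hstay n hn
  simp only [Set.mem_insert_iff, Set.mem_singleton_iff]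
  omega

lemma tendsto_traversals {p : ℕ → ℕ} {x : ℕ}
    (h : ∃ᶠ n in atTop, s(p n, p (n + 1)) = s(x, x + 1)) :
    Tendsto (fun n => traversals p n x) atTop atTop := by
  refine tendsto_atTop_atTop_of_monotone (traversals_mono p x) fun b => ?_
  induction b with
  | zero => exact ⟨0, Nat.zero_le _⟩
  | succ b ih =>
    obtain ⟨a, ha⟩ := ih
    obtain ⟨n, hn, hs⟩ := frequently_atTop.mp h a
    refine ⟨n + 1, ?_⟩
    have := traversals_mono p x hn
    simp only at this
    rw [traversals_succ, if_pos hs]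
    omega

/-- A path that does not traverse the edge `{x, x + 1}` infinitely often has an eventually constant
number of traversals of that edge. -/
lemma exists_eventually_traversals_eq {p : ℕ → ℕ} {x : ℕ}
    (h : ¬ ∃ᶠ n in atTop, s(p n, p (n + 1)) = s(x, x + 1)) :
    ∃ m, ∀ᶠ n in atTop, traversals p n x = m := by
  obtain ⟨N, hN⟩ := eventually_atTop.mp (not_frequently.mp h)
  refine ⟨traversals p N x, eventually_atTop.mpr ⟨N, fun n hn => ?_⟩⟩
  induction n, hn using Nat.le_induction with
  | base => rfl
  | succ n hn ih => rw [traversals_succ, if_neg (hN n hn), ih, add_zero]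

/-! ### One-step laws and expectations of path functionals -/

lemma disjoint_steps {Ω : Type*} {X : ℕ → Ω → ℕ} (p : ℕ → ℕ) (n : ℕ) :
    Disjoint (history X p n ∩ {ω | X (n + 1) ω = p n + 1})
      (history X p n ∩ {ω | X (n + 1) ω + 1 = p n}) :=
  Set.disjoint_left.mpr fun ω h h' => by
    have h1 : X (n + 1) ω = p n + 1 := h.2
    have h2 : X (n + 1) ω + 1 = p n := h'.2
    omega

section Probability

variable {Ω : Type*} [MeasurableSpace Ω] {μ : Measure Ω} {f : ℕ → ℕ → ℝ} {X : ℕ → Ω → ℕ}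

lemma measurableSet_history (hX : ∀ n, Measurable (X n)) (p : ℕ → ℕ) (n : ℕ) :
    MeasurableSet (history X p n) := by
  have : history X p n = ⋂ i, ⋂ _ : i ≤ n, X i ⁻¹' {p i} := by
    ext ω; simp [history]
  rw [this]
  exact MeasurableSet.iInter fun i => MeasurableSet.iInter fun _ =>
    hX i (measurableSet_singleton _)

/-- The integral of `F` is the sum of its integrals over the events prescribing the path up to
time `n`. -/
lemma integral_eq_tsum_history {E : Type*} [NormedAddCommGroup E] [NormedSpace ℝ E]
    (hX : ∀ n, Measurable (X n)) (n : ℕ) {F : Ω → E} (hF : Integrable F μ) :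
    ∫ ω, F ω ∂μ = ∑' h : Fin (n + 1) → ℕ,
      ∫ ω in history X (fun i => h (Fin.ofNat (n + 1) i)) n, F ω ∂μ := by
  rw [← integral_iUnion (fun h => measurableSet_history hX _ n) ?_ hF.integrableOn]
  -- `Fin.ofNat (n + 1) i` is `i` modulo `n + 1`: tuples are extended periodically to paths, and a
  -- history sees only the indices up to `n`.
  · have : (⋃ h : Fin (n + 1) → ℕ, history X (fun i => h (Fin.ofNat (n + 1) i)) n) = Set.univ := by
      refine Set.eq_univ_of_forall fun ω => Set.mem_iUnion.mpr ⟨fun i => X i ω, fun i hi => ?_⟩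
      simp [Nat.mod_eq_of_lt (Nat.lt_succ_of_le hi)]
    rw [this, Measure.restrict_univ]
  · intro h h' hne
    refine Set.disjoint_left.mpr fun ω hω hω' => hne (funext fun i => ?_)
    have h1 := hω i (by omega)
    have h2 := hω' i (by omega)
    simp only [Fin.ofNat_eq_cast, Fin.cast_val_eq_self] at h1 h2
    rw [← h1, ← h2]

variable [IsProbabilityMeasure μ]

lemma measurableSet_right (hX : ∀ n, Measurable (X n)) (n v : ℕ) :
    MeasurableSet {ω | X n ω = v} := hX n (measurableSet_singleton v)

lemma measurableSet_left (hX : ∀ n, Measurable (X n)) (n v : ℕ) :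
    MeasurableSet {ω | X n ω + 1 = v} :=
  hX n (MeasurableSet.of_discrete (s := {k | k + 1 = v}))

lemma IsERRW.measureReal_right (hX : IsERRW μ f X) (p : ℕ → ℕ) (n : ℕ) :
    μ.real (history X p n ∩ {ω | X (n + 1) ω = p n + 1})
      = μ.real (history X p n) * rightProb f p n := by
  by_cases h : μ (history X p n) = 0
  · rw [measureReal_def, measureReal_def, measure_mono_null Set.inter_subset_left h, h]; simp
  · rw [← hX.step_right p n h,
      measureReal_def (μ[|_]), cond_apply (measurableSet_history hX.measurable p n),
      ENNReal.toReal_mul, ENNReal.toReal_inv, ← measureReal_def, ← measureReal_def,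
      mul_inv_cancel_left₀]
    rwa [measureReal_def, ENNReal.toReal_ne_zero, and_iff_left (measure_ne_top _ _)]

lemma IsERRW.measureReal_left (hX : IsERRW μ f X) (p : ℕ → ℕ) (n : ℕ) :
    μ.real (history X p n ∩ {ω | X (n + 1) ω + 1 = p n})
      = μ.real (history X p n) * (1 - rightProb f p n) := by
  by_cases h : μ (history X p n) = 0
  · rw [measureReal_def, measureReal_def, measure_mono_null Set.inter_subset_left h, h]; simp
  · rw [← hX.step_left p n h,
      measureReal_def (μ[|_]), cond_apply (measurableSet_history hX.measurable p n),
      ENNReal.toReal_mul, ENNReal.toReal_inv, ← measureReal_def, ← measureReal_def,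
      mul_inv_cancel_left₀]
    rwa [measureReal_def, ENNReal.toReal_ne_zero, and_iff_left (measure_ne_top _ _)]

/-- Up to a null set, a history is continued by a step to the right or to the left. -/
lemma IsERRW.ae_history_steps (hX : IsERRW μ f X) (p : ℕ → ℕ) (n : ℕ) :
    ((history X p n ∩ {ω | X (n + 1) ω = p n + 1}) ∪
      (history X p n ∩ {ω | X (n + 1) ω + 1 = p n}) : Set Ω) =ᵐ[μ] history X p n := by
  have hR := (measurableSet_history hX.measurable p n).inter
    (measurableSet_right hX.measurable (n + 1) (p n + 1))
  have hL := (measurableSet_history hX.measurable p n).inter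
    (measurableSet_left hX.measurable (n + 1) (p n))
  refine ae_eq_of_subset_of_measure_ge
    (Set.union_subset Set.inter_subset_left Set.inter_subset_left) ?_
    (hR.union hL).nullMeasurableSet (measure_ne_top _ _)
  have h : μ.real ((history X p n ∩ {ω | X (n + 1) ω = p n + 1}) ∪
      (history X p n ∩ {ω | X (n + 1) ω + 1 = p n})) = μ.real (history X p n) := by
    rw [measureReal_union (disjoint_steps p n) hL, hX.measureReal_right, hX.measureReal_left]
    ring
  rw [measureReal_def, measureReal_def,
    ENNReal.toReal_eq_toReal_iff' (measure_ne_top _ _) (measure_ne_top _ _)] at h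
  exact h.ge

/-- Almost surely, the walk makes only nearest-neighbour steps. -/
lemma IsERRW.ae_isNearestNeighbour (hX : IsERRW μ f X) :
    ∀ᵐ ω ∂μ, ∀ n, IsNearestNeighbour (fun i => X i ω) n := by
  have key : ∀ n, ∀ᵐ ω ∂μ, X (n + 1) ω = X n ω + 1 ∨ X (n + 1) ω + 1 = X n ω := by
    intro n
    have h : ∀ h : Fin (n + 1) → ℕ, ∀ᵐ ω ∂μ, ω ∈ history X (fun i => h (Fin.ofNat (n + 1) i)) n →
        X (n + 1) ω = X n ω + 1 ∨ X (n + 1) ω + 1 = X n ω := by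
      intro h
      filter_upwards [(hX.ae_history_steps (fun i => h (Fin.ofNat (n + 1) i)) n).mem_iff]
        with ω hω hm
      have hn := hm n le_rfl
      simp only at hn
      rcases hω.mpr hm with h1 | h1
      · left; rw [hn]; exact h1.2
      · right; rw [hn]; exact h1.2
    filter_upwards [ae_all_iff.mpr h] with ω hω
    refine hω (fun i => X i ω) fun i hi => ?_
    simp [Nat.mod_eq_of_lt (Nat.lt_succ_of_le hi)]
  filter_upwards [ae_all_iff.mpr key] with ω hω n i _
  exact hω i

/-- A non-null history contains a nearest-neighbour sample path. The (sub)martingale relations thus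
need checking only on such paths, where the parity lemmas apply. -/
lemma IsERRW.isNearestNeighbour_of_history (hX : IsERRW μ f X) {p : ℕ → ℕ} {n : ℕ}
    (h : μ (history X p n) ≠ 0) : IsNearestNeighbour p n := by
  obtain ⟨ω, hω, hω'⟩ :=
    ((frequently_ae_mem_iff.mpr h).and_eventually hX.ae_isNearestNeighbour).exists
  intro i hi
  have := hω' n i hi
  simp only at this
  rwa [hω i hi.le, hω (i + 1) hi] at this

/-- The integral of a function of the path up to time `n + 1` over a history up to time `n`. -/
lemma IsERRW.setIntegral_history {E : Type*} [NormedAddCommGroup E] [NormedSpace ℝ E]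
    [CompleteSpace E]
    (hX : IsERRW μ f X) (p : ℕ → ℕ) (n : ℕ) (G : (ℕ → ℕ) → E)
    (hG : ∀ q q' : ℕ → ℕ, (∀ i ≤ n + 1, q i = q' i) → G q = G q')
    (hint : Integrable (fun ω => G fun i => X i ω) μ) :
    ∫ ω in history X p n, G (fun i => X i ω) ∂μ = μ.real (history X p n) •
      (rightProb f p n • G (extend p n (p n + 1))
        + (1 - rightProb f p n) • G (extend p n (p n - 1))) := by
  have hR := (measurableSet_history hX.measurable p n).inter
    (measurableSet_right hX.measurable (n + 1) (p n + 1))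
  have hL := (measurableSet_history hX.measurable p n).inter
    (measurableSet_left hX.measurable (n + 1) (p n))
  have eR : ∫ ω in history X p n ∩ {ω | X (n + 1) ω = p n + 1}, G (fun i => X i ω) ∂μ
      = (μ.real (history X p n) * rightProb f p n) • G (extend p n (p n + 1)) := by
    rw [← hX.measureReal_right, ← setIntegral_const]
    refine setIntegral_congr_fun hR fun ω hω => hG _ _ fun i hi => ?_
    rcases Nat.lt_or_ge n i with h | h
    · obtain rfl : i = n + 1 := by omega
      rw [extend_succ]; exact hω.2
    · rw [extend_of_le p _ h]; exact hω.1 i h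
  have eL : ∫ ω in history X p n ∩ {ω | X (n + 1) ω + 1 = p n}, G (fun i => X i ω) ∂μ
      = (μ.real (history X p n) * (1 - rightProb f p n)) • G (extend p n (p n - 1)) := by
    rw [← hX.measureReal_left, ← setIntegral_const]
    refine setIntegral_congr_fun hL fun ω hω => hG _ _ fun i hi => ?_
    rcases Nat.lt_or_ge n i with h | h
    · obtain rfl : i = n + 1 := by omega
      rw [extend_succ]
      have : X (n + 1) ω + 1 = p n := hω.2
      omega
    · rw [extend_of_le p _ h]; exact hω.1 i h
  rw [← setIntegral_congr_set (hX.ae_history_steps p n),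
    setIntegral_union (disjoint_steps p n) hL hint.integrableOn hint.integrableOn, eR, eL,
    smul_add, smul_smul, smul_smul]

/-- Expectation along a martingale function of the path is preserved by one step. -/
lemma IsERRW.integral_eq_integral_zero {E : Type*} [NormedAddCommGroup E] [NormedSpace ℝ E]
    [CompleteSpace E]
    (hX : IsERRW μ f X) (G : ℕ → (ℕ → ℕ) → E)
    (hG : ∀ n, ∀ q q' : ℕ → ℕ, (∀ i ≤ n, q i = q' i) → G n q = G n q')
    (hint : ∀ n, Integrable (fun ω => G n fun i => X i ω) μ)
    (hmart : ∀ p n, IsNearestNeighbour p n →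
      rightProb f p n • G (n + 1) (extend p n (p n + 1))
        + (1 - rightProb f p n) • G (n + 1) (extend p n (p n - 1)) = G n p) (n : ℕ) :
    ∫ ω, G n (fun i => X i ω) ∂μ = ∫ ω, G 0 (fun i => X i ω) ∂μ := by
  induction n with
  | zero => rfl
  | succ n ih =>
    rw [← ih, integral_eq_tsum_history hX.measurable n (hint (n + 1)),
      integral_eq_tsum_history hX.measurable n (hint n)]
    refine tsum_congr fun h => ?_
    set p : ℕ → ℕ := fun i => h (Fin.ofNat (n + 1) i)
    by_cases h0 : μ (history X p n) = 0
    · rw [Measure.restrict_eq_zero.mpr h0, integral_zero_measure, integral_zero_measure]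
    · rw [hX.setIntegral_history p n (G (n + 1)) (hG (n + 1)) (hint (n + 1)),
        hmart p n (hX.isNearestNeighbour_of_history h0), ← setIntegral_const]
      exact setIntegral_congr_fun (measurableSet_history hX.measurable p n)
        fun ω hω => (hG n _ _ hω).symm

/-- Expectation along a submartingale function of the path is non-decreasing. -/
lemma IsERRW.integral_zero_le
    (hX : IsERRW μ f X) (G : ℕ → (ℕ → ℕ) → ℝ)
    (hG : ∀ n, ∀ q q' : ℕ → ℕ, (∀ i ≤ n, q i = q' i) → G n q = G n q')
    (hint : ∀ n, Integrable (fun ω => G n fun i => X i ω) μ)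
    (hmart : ∀ p n, IsNearestNeighbour p n →
      G n p ≤ rightProb f p n * G (n + 1) (extend p n (p n + 1))
        + (1 - rightProb f p n) * G (n + 1) (extend p n (p n - 1))) (n : ℕ) :
    ∫ ω, G 0 (fun i => X i ω) ∂μ ≤ ∫ ω, G n (fun i => X i ω) ∂μ := by
  induction n with
  | zero => rfl
  | succ n ih =>
    refine ih.trans ?_
    rw [← sub_nonneg, ← integral_sub (hint _) (hint _),
      integral_eq_tsum_history (F := fun ω => G (n + 1) (fun i => X i ω) -
        G n (fun i => X i ω)) hX.measurable n ((hint (n + 1)).sub (hint n))]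
    refine tsum_nonneg fun h => ?_
    set p : ℕ → ℕ := fun i => h (Fin.ofNat (n + 1) i)
    by_cases h0 : μ (history X p n) = 0
    · rw [Measure.restrict_eq_zero.mpr h0, integral_zero_measure]
    · have e : ∫ ω in history X p n, G n (fun i => X i ω) ∂μ
          = μ.real (history X p n) • G n p := by
        rw [← setIntegral_const]
        exact setIntegral_congr_fun (measurableSet_history hX.measurable p n)
          fun ω hω => hG n _ _ hω
      rw [integral_sub (hint _).integrableOn (hint _).integrableOn, e,
        hX.setIntegral_history p n (G (n + 1)) (hG (n + 1)) (hint (n + 1)), ← smul_sub]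
      refine smul_nonneg measureReal_nonneg (sub_nonneg.mpr ?_)
      exact hmart p n (hX.isNearestNeighbour_of_history h0)

lemma measurable_traversals (hX : ∀ n, Measurable (X n)) (n x : ℕ) :
    Measurable fun ω => traversals (fun i => X i ω) n x := by
  induction n with
  | zero => simp only [traversals_zero]; exact measurable_const
  | succ n ih =>
    simp only [traversals_succ]
    refine ih.add (?_ : Measurable ((fun z : ℕ × ℕ => if s(z.1, z.2) = s(x, x + 1) then 1 else 0) ∘
      fun ω => (X n ω, X (n + 1) ω)))
    exact (measurable_of_countable _).comp ((hX n).prodMk (hX (n + 1)))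

lemma integrable_of_traversals {E : Type*} [NormedAddCommGroup E]
    (hX : ∀ n, Measurable (X n)) (g : ℕ → ℕ → ℕ → E) {B : ℝ} (hg : ∀ a b c, ‖g a b c‖ ≤ B)
    (n x x' : ℕ) :
    Integrable (fun ω => g (X 0 ω) (traversals (fun i => X i ω) n x)
      (traversals (fun i => X i ω) n x')) μ := by
  refine Integrable.of_bound (C := B) ?_ (Eventually.of_forall fun ω => hg _ _ _)
  have h : StronglyMeasurable fun z : ℕ × ℕ × ℕ => g z.1 z.2.1 z.2.2 := .of_discrete
  exact (h.comp_measurable ((hX 0).prodMk ((measurable_traversals hX n x).prodMk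
    (measurable_traversals hX n x')))).aestronglyMeasurable

end Probability

/-! ### Boundedness of the range -/

section BoundedRange

/-- A lower bound for the probability that a walk that has traversed the edge `{x, x + 1}` `m` times
and has not traversed `{x + 1, x + 2}` never traverses the latter. -/
noncomputable def survivalBound (C : ℝ) (δ : ℕ → ℝ) (m : ℕ) : ℝ :=
  Real.exp (-(C * ∑' k, (δ (k + m))⁻¹))

variable {C : ℝ} {δ : ℕ → ℝ}

lemma survivalBound_pos (C : ℝ) (δ : ℕ → ℝ) (m : ℕ) : 0 < survivalBound C δ m := Real.exp_pos _

lemma survivalBound_le_one (hC : 0 < C) (hδ : ∀ k, 0 < δ k) (m : ℕ) :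
    survivalBound C δ m ≤ 1 := by
  rw [survivalBound, Real.exp_le_one_iff, neg_nonpos]
  exact mul_nonneg hC.le (tsum_nonneg fun k => (inv_pos.mpr (hδ _)).le)

/-- Consecutive bounds differ by the factor `exp (C / δ m) ≥ 1 + C / δ m`. This compensates the cost
`1 / (1 + C / δ m)` of one left step from `x + 1`. -/
lemma survivalBound_mul_le (C : ℝ) (hsum : Summable fun k => (δ k)⁻¹) (m : ℕ) : (1 + C / δ m) * survivalBound C δ m ≤ survivalBound C δ (m + 1) := by
  have h : ∑' k, (δ (k + m))⁻¹ = (δ m)⁻¹ + ∑' k, (δ (k + (m + 1)))⁻¹ := by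
    rw [((summable_nat_add_iff m).mpr hsum).tsum_eq_zero_add, zero_add]
    simp only [add_assoc, add_comm 1 m]
  have h' : survivalBound C δ (m + 1) = Real.exp (C / δ m) * survivalBound C δ m := by
    unfold survivalBound
    rw [h, ← Real.exp_add]
    congr 1
    ring
  rw [h']
  refine mul_le_mul_of_nonneg_right ?_ (survivalBound_pos C δ m).le
  rw [add_comm]
  exact Real.add_one_le_exp _

lemma survivalBound_mono (hC : 0 < C) (hδ : ∀ k, 0 < δ k) (hsum : Summable fun k => (δ k)⁻¹) :
    Monotone (survivalBound C δ) :=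
  monotone_nat_of_le_succ fun m => by
    refine le_trans ?_ (survivalBound_mul_le C hsum m)
    have := mul_pos (div_pos hC (hδ m)) (survivalBound_pos C δ m)
    linarith

/-- The submartingale comparing the probabilities that `{x, x + 1}` and `{x + 1, x + 2}` are ever
traversed, as a function of the starting point `a`, and the numbers `m` and `m'` of traversals of
these edges. -/
noncomputable def survivalFunction (C : ℝ) (δ : ℕ → ℝ) (y a m m' : ℕ) : ℝ :=
  if a = y ∧ 0 < m then (if m' = 0 then survivalBound C δ m else 0) - survivalBound C δ 0 else 0

lemma abs_survivalFunction_le (hC : 0 < C) (hδ : ∀ k, 0 < δ k) (y a m m' : ℕ) :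
    ‖survivalFunction C δ y a m m'‖ ≤ 1 := by
  have h := survivalBound_pos C δ m
  have h' := survivalBound_le_one hC hδ m
  have h0 := survivalBound_pos C δ 0
  have h0' := survivalBound_le_one hC hδ 0
  rw [Real.norm_eq_abs, abs_le, survivalFunction]
  split_ifs <;> constructor <;> linarith

/-- Only a departure from `x + 1` can lose anything. Of the other steps, `x → x + 1` raises the
bound by monotonicity, and `x + 2 → x + 1` crosses an edge already used. -/
lemma survivalFunction_step {f : ℕ → ℕ → ℝ} (hf : IsReinforcementScheme f) (hδ : IsFTR f δ)
    (hC : 0 < C) (hfC : ∀ x : ℕ, f 0 (x + 1) / f 0 x ≤ C) (hsum : Summable fun k => (δ k)⁻¹)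
    {x y : ℕ} (hy : y ≤ x) (p : ℕ → ℕ) (n : ℕ) (hp : IsNearestNeighbour p n) :
    survivalFunction C δ y (p 0) (traversals p n x) (traversals p n (x + 1)) ≤
      rightProb f p n * survivalFunction C δ y (extend p n (p n + 1) 0)
          (traversals (extend p n (p n + 1)) (n + 1) x)
          (traversals (extend p n (p n + 1)) (n + 1) (x + 1))
        + (1 - rightProb f p n) * survivalFunction C δ y (extend p n (p n - 1) 0)
          (traversals (extend p n (p n - 1)) (n + 1) x)
          (traversals (extend p n (p n - 1)) (n + 1) (x + 1)) := by
  have hmono := survivalBound_mono hC hδ.pos hsum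
  simp only [traversals_extend_right, traversals_extend_left, extend_of_le p _ (Nat.zero_le n)]
  by_cases h0 : p 0 = y
  swap
  · simp [survivalFunction, h0]
  have hlast := le_of_traversals_eq_zero (x := x) hp (by omega)
  have hlast' := le_of_traversals_eq_zero (x := x + 1) hp (by omega)
  have hnext := traversals_succ_eq_zero (x := x) hp (by omega)
  rcases eq_or_ne (p n) (x + 1) with hu | hu
  · have hr : rightProb f p n = f (traversals p n (x + 1)) (x + 1) /
        (f (traversals p n x) x + f (traversals p n (x + 1)) (x + 1)) := by
      simp [rightProb, hu, leftWeight, weight]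
    generalize rightProb f p n = r at hr ⊢
    simp only [hu]
    generalize traversals p n x = m at *
    generalize traversals p n (x + 1) = m' at *
    have hm : 0 < m := by
      by_contra hm
      have := hlast (by omega)
      omega
    simp only [survivalFunction, h0, hm, true_and, if_true]
    rcases Nat.eq_zero_or_pos m' with rfl | hm'
    · have key : survivalBound C δ m ≤ (1 - r) * survivalBound C δ (m + 1) := by
        have hpos := hf.pos m x
        have hpos' := hf.pos 0 (x + 1)
        have hpos0 := hf.pos 0 x
        have hd := hδ.pos m
        have e : 1 - r = f m x / (f m x + f 0 (x + 1)) := by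
          rw [hr]; field_simp; ring
        have hle : f m x + f 0 (x + 1) ≤ (1 + C / δ m) * f m x := by
          rw [hδ.factor m x]
          have := (div_le_iff₀ hpos0).mp (hfC x)
          field_simp
          nlinarith
        rw [e, div_mul_eq_mul_div, le_div_iff₀ (by positivity)]
        calc survivalBound C δ m * (f m x + f 0 (x + 1))
            ≤ survivalBound C δ m * ((1 + C / δ m) * f m x) :=
              mul_le_mul_of_nonneg_left hle (survivalBound_pos _ _ _).le
          _ = f m x * ((1 + C / δ m) * survivalBound C δ m) := by ring
          _ ≤ f m x * survivalBound C δ (m + 1) :=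
              mul_le_mul_of_nonneg_left (survivalBound_mul_le C hsum m) hpos.le
      simp [hm]
      linarith
    · simp [hm, hm'.ne']
      linarith
  · have hR : survivalFunction C δ y (p 0) (traversals p n x) (traversals p n (x + 1)) ≤
        survivalFunction C δ y (p 0) (traversals p n x + if p n = x then 1 else 0)
          (traversals p n (x + 1) + if p n = x + 1 then 1 else 0) := by
      rw [if_neg hu, add_zero]
      split_ifs with hx
      · generalize traversals p n x = m at *
        generalize traversals p n (x + 1) = m' at *
        rcases Nat.eq_zero_or_pos m with rfl | hm
        -- First crossing of `{x, x + 1}`: the value passes from `0` to `survivalBound C δ 1 -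
        -- survivalBound C δ 0 ≥ 0`.
        · simp [survivalFunction, h0, hnext rfl, hmono (Nat.zero_le 1)]
        · have := hmono (Nat.le_succ m)
          simp only [survivalFunction, h0, hm, Nat.succ_pos, and_self, if_true]
          split_ifs <;> simp_all
      · exact le_rfl
    have hL : survivalFunction C δ y (p 0) (traversals p n x) (traversals p n (x + 1)) =
        survivalFunction C δ y (p 0) (traversals p n x + if p n = x + 1 then 1 else 0)
          (traversals p n (x + 1) + if p n = x + 1 + 1 then 1 else 0) := by
      rw [if_neg hu, add_zero]
      split_ifs with hx
      · have hm' : traversals p n (x + 1) ≠ 0 := fun h => by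
          have := hlast' h
          omega
        simp [survivalFunction, hm']
      · rfl
    rw [← hL]
    have hr : 0 ≤ rightProb f p n := by
      have h1 := hf.pos (traversals p n (p n)) (p n)
      unfold rightProb
      refine div_nonneg h1.le (add_nonneg ?_ h1.le)
      rcases p n with _ | u
      · exact le_rfl
      · exact (hf.pos _ _).le
    have := mul_le_mul_of_nonneg_left hR hr
    linarith

variable {Ω : Type*} [MeasurableSpace Ω] {μ : Measure Ω} {f : ℕ → ℕ → ℝ} {X : ℕ → Ω → ℕ}
  [IsProbabilityMeasure μ]

lemma measurableSet_traversed (hX : ∀ n, Measurable (X n)) (y n x : ℕ) :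
    MeasurableSet {ω | X 0 ω = y ∧ 0 < traversals (fun i => X i ω) n x} :=
  (measurableSet_right hX 0 y).inter (measurable_traversals hX n x measurableSet_Ioi)

/-- Each new edge is traversed with a conditional probability bounded away from one. -/
lemma IsERRW.measureReal_traversed_succ_le (hf : IsReinforcementScheme f) (hX : IsERRW μ f X)
    (hδ : IsFTR f δ) (hC : 0 < C) (hfC : ∀ x : ℕ, f 0 (x + 1) / f 0 x ≤ C)
    (hsum : Summable fun k => (δ k)⁻¹) {x y : ℕ} (hy : y ≤ x) (n : ℕ) :
    μ.real {ω | X 0 ω = y ∧ 0 < traversals (fun i => X i ω) n (x + 1)} ≤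
      (1 - survivalBound C δ 0) *
        μ.real {ω | X 0 ω = y ∧ 0 < traversals (fun i => X i ω) n x} := by
  have hint := fun n => integrable_of_traversals (μ := μ) hX.measurable (survivalFunction C δ y)
    (abs_survivalFunction_le hC hδ.pos y) n x (x + 1)
  have h := hX.integral_zero_le
    (fun n p => survivalFunction C δ y (p 0) (traversals p n x) (traversals p n (x + 1)))
    (fun n q q' hq => by
      rw [hq 0 (Nat.zero_le n), traversals_congr hq, traversals_congr hq])
    hint (survivalFunction_step hf hδ hC hfC hsum hy) n
  -- The condition `0 < m` in `survivalFunction` makes the initial value vanish.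
  have h0 : ∀ ω, survivalFunction C δ y (X 0 ω) (traversals (fun i => X i ω) 0 x)
      (traversals (fun i => X i ω) 0 (x + 1)) = 0 := fun ω => by
    simp [survivalFunction, traversals_zero]
  simp only [h0, integral_zero] at h
  have hA := measurableSet_traversed hX.measurable y n x
  have hB := measurableSet_traversed hX.measurable y n (x + 1)
  set A := {ω | X 0 ω = y ∧ 0 < traversals (fun i => X i ω) n x}
  set B := {ω | X 0 ω = y ∧ 0 < traversals (fun i => X i ω) n (x + 1)}
  -- Almost surely `B ⊆ A`. The integrand is at most `1 - survivalBound C δ 0` on `A \ B` and equals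
  -- `-survivalBound C δ 0` on `B`.
  have hle : ∫ ω, survivalFunction C δ y (X 0 ω) (traversals (fun i => X i ω) n x)
      (traversals (fun i => X i ω) n (x + 1)) ∂μ ≤
      ∫ ω, (1 - survivalBound C δ 0) * A.indicator 1 ω - B.indicator 1 ω ∂μ := by
    refine integral_mono_ae (hint n) ?_ ?_
    · exact (((integrable_const 1).indicator hA).const_mul _).sub
        ((integrable_const 1).indicator hB)
    · filter_upwards [hX.ae_isNearestNeighbour] with ω hω
      have hnext := traversals_succ_eq_zero (x := x) (hω n)
      have hle1 := survivalBound_le_one hC hδ.pos (traversals (fun i => X i ω) n x)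
      by_cases h0 : X 0 ω = y
      · have hnext := hnext (by omega)
        rcases Nat.eq_zero_or_pos (traversals (fun i => X i ω) n x) with h1 | h1
        · simp [survivalFunction, A, B, Set.indicator, h1, hnext h1]
        · rcases Nat.eq_zero_or_pos (traversals (fun i => X i ω) n (x + 1)) with h2 | h2
          · simp [survivalFunction, A, B, Set.indicator, h0, h1, h2]
            exact hle1
          · simp [survivalFunction, A, B, Set.indicator, h0, h1, h2, h2.ne']
      · simp [survivalFunction, A, B, Set.indicator, h0]
  rw [integral_sub (((integrable_const 1).indicator hA).const_mul _)
    ((integrable_const 1).indicator hB), integral_const_mul, integral_indicator_one hA,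
    integral_indicator_one hB] at hle
  linarith

/-- Almost surely, some edge to the right of the starting point is never traversed. -/
lemma IsERRW.ae_exists_traversals_eq_zero (hf : IsReinforcementScheme f) (hX : IsERRW μ f X)
    (hδ : IsFTR f δ) (hC : 0 < C) (hfC : ∀ x : ℕ, f 0 (x + 1) / f 0 x ≤ C)
    (hsum : Summable fun k => (δ k)⁻¹) :
    ∀ᵐ ω ∂μ, ∃ z, X 0 ω ≤ z ∧ ∀ n, traversals (fun i => X i ω) n z = 0 := by
  have hc := survivalBound_pos C δ 0
  have hc' := survivalBound_le_one hC hδ.pos 0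
  have hgeom : ∀ y n k, μ.real {ω | X 0 ω = y ∧ 0 < traversals (fun i => X i ω) n (y + k)} ≤
      (1 - survivalBound C δ 0) ^ k := by
    intro y n k
    induction k with
    | zero => simp
    | succ k ih =>
      refine (hX.measureReal_traversed_succ_le hf hδ hC hfC hsum (Nat.le_add_right y k) n).trans ?_
      rw [pow_succ']
      exact mul_le_mul_of_nonneg_left ih (by linarith)
  have hunion : ∀ y k, μ.real (⋃ n, {ω | X 0 ω = y ∧ 0 < traversals (fun i => X i ω) n (y + k)}) ≤
      (1 - survivalBound C δ 0) ^ k := by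
    intro y k
    have hmono : Monotone fun n => {ω | X 0 ω = y ∧ 0 < traversals (fun i => X i ω) n (y + k)} :=
      fun n n' hn ω hω => ⟨hω.1, hω.2.trans_le (traversals_mono _ _ hn)⟩
    have ht := (ENNReal.tendsto_toReal (measure_ne_top μ _)).comp
      (tendsto_measure_iUnion_atTop (μ := μ) hmono)
    exact le_of_tendsto ht (Eventually.of_forall fun n => hgeom y n k)
  have hnull : ∀ y, μ (⋂ k, ⋃ n, {ω | X 0 ω = y ∧ 0 < traversals (fun i => X i ω) n (y + k)})
      = 0 := by
    intro y
    rw [← measureReal_eq_zero_iff]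
    refine le_antisymm (ge_of_tendsto
      (tendsto_pow_atTop_nhds_zero_of_lt_one (r := 1 - survivalBound C δ 0) (by linarith)
        (by linarith))
      (Eventually.of_forall fun k => ?_)) measureReal_nonneg
    exact (measureReal_mono (Set.iInter_subset _ k)).trans (hunion y k)
  filter_upwards [ae_all_iff.mpr fun y => measure_eq_zero_iff_ae_notMem.mp (hnull y)] with ω hω
  have := hω (X 0 ω)
  simp only [Set.mem_iInter, Set.mem_iUnion, not_forall, not_exists] at this
  obtain ⟨k, hk⟩ := this
  refine ⟨X 0 ω + k, Nat.le_add_right _ _, fun n => ?_⟩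
  by_contra hne
  exact hk n ⟨rfl, Nat.pos_of_ne_zero hne⟩

end BoundedRange

/-! ### Products of reciprocal characteristic functions -/

section PhaseProducts

/-- The reciprocal, at `-t`, of the characteristic function of an exponential variable with rate
`g k`, if `k` has parity `ε`, and `1` otherwise. -/
noncomputable def phaseFactor (g : ℕ → ℝ) (ε : ℕ) (t : ℝ) (k : ℕ) : ℂ :=
  if k % 2 = ε then 1 + (t / g k : ℝ) * Complex.I else 1

/-- The inverse of the infinite product of the phase factors with index at least `m`. -/
noncomputable def phaseRatio (g : ℕ → ℝ) (ε : ℕ) (t : ℝ) (m : ℕ) : ℂ :=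
  (∏ k ∈ Finset.range m, phaseFactor g ε t k) / ∏' k, phaseFactor g ε t k

variable {g : ℕ → ℝ} {ε : ℕ} {t : ℝ}

lemma one_le_norm_phaseFactor (g : ℕ → ℝ) (ε : ℕ) (t : ℝ) (k : ℕ) :
    1 ≤ ‖phaseFactor g ε t k‖ := by
  unfold phaseFactor
  split_ifs
  · refine le_trans ?_ (Complex.abs_re_le_norm _)
    simp
  · simp

lemma abs_div_le_norm_phaseFactor (g : ℕ → ℝ) (t : ℝ) {k : ℕ} (hk : k % 2 = ε) :
    |t / g k| ≤ ‖phaseFactor g ε t k‖ := by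
  rw [phaseFactor, if_pos hk]
  refine le_trans (le_of_eq ?_) (Complex.abs_im_le_norm _)
  simp

lemma multipliable_phaseFactor (hg : ∀ k, 0 < g k) (hsum : Summable fun k => (g k)⁻¹)
    (ε : ℕ) (t : ℝ) : Multipliable (phaseFactor g ε t) := by
  have h : phaseFactor g ε t =
      fun k => 1 + if k % 2 = ε then ((t / g k : ℝ) : ℂ) * Complex.I else 0 := by
    funext k
    unfold phaseFactor
    split_ifs <;> simp
  rw [h]
  refine multipliable_one_add_of_summable
    (Summable.of_nonneg_of_le (fun _ => norm_nonneg _) (fun k => ?_) (hsum.mul_left |t|))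
  split_ifs
  · rw [norm_mul, Complex.norm_I, mul_one, Complex.norm_real, Real.norm_eq_abs, abs_div,
      abs_of_pos (hg k), div_eq_mul_inv]
  · rw [norm_zero]
    exact mul_nonneg (abs_nonneg t) (inv_pos.mpr (hg k)).le

lemma norm_prod_phaseFactor_mono (g : ℕ → ℝ) (ε : ℕ) (t : ℝ) :
    Monotone fun m => ‖∏ k ∈ Finset.range m, phaseFactor g ε t k‖ :=
  monotone_nat_of_le_succ fun m => by
    rw [Finset.prod_range_succ, norm_mul]
    exact le_mul_of_one_le_right (norm_nonneg _) (one_le_norm_phaseFactor g ε t m)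

lemma norm_prod_le_norm_tprod (hg : ∀ k, 0 < g k) (hsum : Summable fun k => (g k)⁻¹)
    (ε : ℕ) (t : ℝ) (m : ℕ) :
    ‖∏ k ∈ Finset.range m, phaseFactor g ε t k‖ ≤ ‖∏' k, phaseFactor g ε t k‖ :=
  (norm_prod_phaseFactor_mono g ε t).ge_of_tendsto
    (multipliable_phaseFactor hg hsum ε t).tendsto_prod_tprod_nat.norm m

/-- Every factor has norm at least one, so the infinite product cannot vanish. -/
lemma norm_tprod_phaseFactor_pos (hg : ∀ k, 0 < g k) (hsum : Summable fun k => (g k)⁻¹)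
    (ε : ℕ) (t : ℝ) : 0 < ‖∏' k, phaseFactor g ε t k‖ := by
  have := norm_prod_le_norm_tprod hg hsum ε t 0
  rw [Finset.prod_range_zero, norm_one] at this
  linarith

lemma norm_phaseRatio_le_one (hg : ∀ k, 0 < g k) (hsum : Summable fun k => (g k)⁻¹)
    (ε : ℕ) (t : ℝ) (m : ℕ) : ‖phaseRatio g ε t m‖ ≤ 1 := by
  rw [phaseRatio, norm_div, div_le_one (norm_tprod_phaseFactor_pos hg hsum ε t)]
  exact norm_prod_le_norm_tprod hg hsum ε t m

lemma tendsto_phaseRatio (hg : ∀ k, 0 < g k) (hsum : Summable fun k => (g k)⁻¹)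
    (ε : ℕ) (t : ℝ) : Tendsto (phaseRatio g ε t) atTop (nhds 1) := by
  have hne := norm_pos_iff.mp (norm_tprod_phaseFactor_pos hg hsum ε t)
  have := (multipliable_phaseFactor hg hsum ε t).tendsto_prod_tprod_nat.div_const
    (∏' k, phaseFactor g ε t k)
  rwa [div_self hne] at this

lemma phaseRatio_succ (g : ℕ → ℝ) (ε : ℕ) (t : ℝ) (m : ℕ) :
    phaseRatio g ε t (m + 1) = phaseRatio g ε t m * phaseFactor g ε t m := by
  rw [phaseRatio, phaseRatio, Finset.prod_range_succ]
  ring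

lemma phaseRatio_succ_of_ne (g : ℕ → ℝ) (t : ℝ) {m : ℕ} (hm : m % 2 ≠ ε) :
    phaseRatio g ε t (m + 1) = phaseRatio g ε t m := by
  rw [phaseRatio_succ, phaseFactor, if_neg hm, mul_one]

/-- A single remaining factor, the one with index `k`, already gives decay in `t`; the others have
norm at least one. -/
lemma norm_phaseRatio_le (hg : ∀ k, 0 < g k) (hsum : Summable fun k => (g k)⁻¹)
    (ht : t ≠ 0) {m k : ℕ} (hmk : m ≤ k) (hk : k % 2 = ε) :
    ‖phaseRatio g ε t m‖ ≤ g k / |t| := by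
  have h1 := norm_prod_le_norm_tprod hg hsum ε t (k + 1)
  rw [Finset.prod_range_succ, norm_mul] at h1
  have h2 := norm_prod_phaseFactor_mono g ε t hmk
  simp only at h2
  have h3 := abs_div_le_norm_phaseFactor g t hk
  rw [abs_div, abs_of_pos (hg k)] at h3
  have ht' : 0 < |t| := abs_pos.mpr ht
  rw [phaseRatio, norm_div, div_le_div_iff₀ (norm_tprod_phaseFactor_pos hg hsum ε t) ht']
  have h4 : ‖∏ k ∈ Finset.range m, phaseFactor g ε t k‖ * (|t| / g k)
      ≤ ‖∏' k, phaseFactor g ε t k‖ :=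
    (mul_le_mul h2 h3 (div_nonneg ht'.le (hg k).le) (norm_nonneg _)).trans h1
  rw [← mul_div_assoc, div_le_iff₀ (hg k)] at h4
  linarith

lemma tendsto_phaseRatio_zero (hg : ∀ k, 0 < g k) (hsum : Summable fun k => (g k)⁻¹)
    (hε : ε < 2) {t : ℕ → ℝ} (ht : ∀ N, |t N| = N + 1) (m : ℕ) :
    Tendsto (fun N => phaseRatio g ε (t N) m) atTop (nhds 0) := by
  refine squeeze_zero_norm (a := fun N : ℕ => g (2 * m + ε) * (1 / ((N : ℝ) + 1))) (fun N => ?_) ?_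
  -- The index `2 * m + ε` is at least `m` and has parity `ε`.
  · have h := norm_phaseRatio_le (t := t N) (ε := ε) (m := m) (k := 2 * m + ε) hg hsum ?_
      (by omega) (by omega)
    · rwa [ht N, div_eq_mul_one_div] at h
    · rw [← abs_pos, ht N]
      positivity
  · simpa using (tendsto_one_div_add_atTop_nhds_zero_nat (𝕜 := ℝ)).const_mul (g (2 * m + ε))

/-- The limits of the phase ratios along the numbers of traversals of an edge tend, as the frequency
tends to infinity, to the indicator of the event that this edge is traversed infinitely often. -/
lemma exists_limit_phaseRatio (hg : ∀ k, 0 < g k) (hsum : Summable fun k => (g k)⁻¹)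
    (hε : ε < 2) {t : ℕ → ℝ} (ht : ∀ N, |t N| = N + 1) (p : ℕ → ℕ) (x : ℕ) :
    ∃ w : ℕ → ℂ, (∀ N, Tendsto (fun n => phaseRatio g ε (t N) (traversals p n x)) atTop
      (nhds (w N))) ∧
      ((∃ᶠ n in atTop, s(p n, p (n + 1)) = s(x, x + 1)) → Tendsto w atTop (nhds 1)) ∧
      ((¬ ∃ᶠ n in atTop, s(p n, p (n + 1)) = s(x, x + 1)) → Tendsto w atTop (nhds 0)) := by
  by_cases h : ∃ᶠ n in atTop, s(p n, p (n + 1)) = s(x, x + 1)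
  · exact ⟨fun _ => 1, fun N => (tendsto_phaseRatio hg hsum ε (t N)).comp (tendsto_traversals h),
      fun _ => tendsto_const_nhds, fun h' => absurd h h'⟩
  · obtain ⟨m, hm⟩ := exists_eventually_traversals_eq h
    refine ⟨fun N => phaseRatio g ε (t N) m, fun N => ?_, fun h' => absurd h' h,
      fun _ => tendsto_phaseRatio_zero hg hsum hε ht m⟩
    exact tendsto_const_nhds.congr' (hm.mono fun n hn => by simp only [hn])

end PhaseProducts

/-! ### Adjacent edges are not both crossed infinitely often -/

section AdjacentEdges

/-- The parity of the number of traversals of the edge `{x, x + 1}` at the visits to its right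
endpoint, for a path started at `y`. -/
def leftParity (y x : ℕ) : ℕ := if y ≤ x then 1 else 0

/-- The parity of the number of traversals of the edge `{x, x + 1}` at the visits to its left
endpoint, for a path started at `y`. -/
def rightParity (y x : ℕ) : ℕ := if y ≤ x then 0 else 1

/-- The complex martingale that detects whether `{x, x + 1}` and `{x + 1, x + 2}` are both traversed
infinitely often, as a function of the starting point `a` and the numbers `m` and `m'` of traversals
of these edges. -/
noncomputable def phaseFunction (f : ℕ → ℕ → ℝ) (x y : ℕ) (t : ℝ) (a m m' : ℕ) : ℂ :=
  if a = y then phaseRatio (fun k => f k x) (leftParity y x) (-t) m *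
    phaseRatio (fun k => f k (x + 1)) (rightParity y (x + 1)) t m' else 0

/-- With weights `a`, `b` to the left and right of `x + 1`, the mean multiplier is `(a * (1 - i t /
a) + b * (1 + i t / b)) / (a + b) = 1`; the opposite signs of `t` make the phases cancel. Crossings
towards `x + 1` have the other parity and carry the factor one. -/
lemma phaseFunction_step {f : ℕ → ℕ → ℝ} (hf : IsReinforcementScheme f) (x y : ℕ) (t : ℝ)
    (p : ℕ → ℕ) (n : ℕ) (hp : IsNearestNeighbour p n) :
    rightProb f p n • phaseFunction f x y t (extend p n (p n + 1) 0)
          (traversals (extend p n (p n + 1)) (n + 1) x)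
          (traversals (extend p n (p n + 1)) (n + 1) (x + 1))
        + (1 - rightProb f p n) • phaseFunction f x y t (extend p n (p n - 1) 0)
          (traversals (extend p n (p n - 1)) (n + 1) x)
          (traversals (extend p n (p n - 1)) (n + 1) (x + 1)) =
      phaseFunction f x y t (p 0) (traversals p n x) (traversals p n (x + 1)) := by
  simp only [traversals_extend_right, traversals_extend_left, extend_of_le p _ (Nat.zero_le n)]
  by_cases h0 : p 0 = y
  swap
  · simp [phaseFunction, h0]
  have hpar := traversals_mod_two hp x
  have hpar' := traversals_mod_two hp (x + 1)
  rw [h0] at hpar hpar'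
  rcases eq_or_ne (p n) (x + 1) with hu | hu
  · have hr : rightProb f p n = f (traversals p n (x + 1)) (x + 1) /
        (f (traversals p n x) x + f (traversals p n (x + 1)) (x + 1)) := by
      simp [rightProb, hu, leftWeight, weight]
    have hL : traversals p n x % 2 = leftParity y x := by
      rw [hpar, leftParity, hu]; split_ifs <;> omega
    have hR : traversals p n (x + 1) % 2 = rightParity y (x + 1) := by
      rw [hpar', rightParity, hu]; split_ifs <;> omega
    rw [hr]
    simp only [hu, h0]
    generalize traversals p n x = m at *
    generalize traversals p n (x + 1) = m' at *
    have hpos := hf.pos m x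
    have hpos' := hf.pos m' (x + 1)
    simp only [phaseFunction, if_true, if_neg (Nat.succ_ne_self x),
      if_neg (show x + 1 ≠ x + 1 + 1 by omega), add_zero, phaseRatio_succ, phaseFactor,
      if_pos hL, if_pos hR, Complex.real_smul]
    generalize phaseRatio (fun k => f k x) (leftParity y x) (-t) m = A
    generalize phaseRatio (fun k => f k (x + 1)) (rightParity y (x + 1)) t m' = B
    generalize f m x = a at *
    generalize f m' (x + 1) = b at *
    have ha : (a : ℂ) ≠ 0 := by exact_mod_cast hpos.ne'
    have hb : (b : ℂ) ≠ 0 := by exact_mod_cast hpos'.ne'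
    have hab : (a : ℂ) + b ≠ 0 := by exact_mod_cast (add_pos hpos hpos').ne'
    push_cast
    field_simp
    ring
  · have hR : phaseFunction f x y t (p 0) (traversals p n x + if p n = x then 1 else 0)
          (traversals p n (x + 1) + if p n = x + 1 then 1 else 0) =
        phaseFunction f x y t (p 0) (traversals p n x) (traversals p n (x + 1)) := by
      rw [if_neg hu, add_zero]
      split_ifs with hx
      · have hne : traversals p n x % 2 ≠ leftParity y x := by
          rw [hpar, leftParity, hx]; split_ifs <;> omega
        rw [phaseFunction, phaseFunction, phaseRatio_succ_of_ne _ _ hne]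
      · rfl
    have hL : phaseFunction f x y t (p 0) (traversals p n x + if p n = x + 1 then 1 else 0)
          (traversals p n (x + 1) + if p n = x + 1 + 1 then 1 else 0) =
        phaseFunction f x y t (p 0) (traversals p n x) (traversals p n (x + 1)) := by
      rw [if_neg hu, add_zero]
      split_ifs with hx
      · have hne : traversals p n (x + 1) % 2 ≠ rightParity y (x + 1) := by
          rw [hpar', rightParity, hx]; split_ifs <;> omega
        rw [phaseFunction, phaseFunction, phaseRatio_succ_of_ne _ _ hne]
      · rfl
    rw [hR, hL, ← add_smul, add_sub_cancel, one_smul]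

variable {Ω : Type*} [MeasurableSpace Ω] {μ : Measure Ω} {f : ℕ → ℕ → ℝ} {X : ℕ → Ω → ℕ}

lemma measurableSet_frequently_edge (hX : ∀ n, Measurable (X n)) (x : ℕ) :
    MeasurableSet {ω | ∃ᶠ n in atTop, s(X n ω, X (n + 1) ω) = s(x, x + 1)} := by
  have h : {ω | ∃ᶠ n in atTop, s(X n ω, X (n + 1) ω) = s(x, x + 1)} =
      ⋂ a, ⋃ n, ⋃ _ : a ≤ n, (fun ω => (X n ω, X (n + 1) ω)) ⁻¹'
        {z : ℕ × ℕ | s(z.1, z.2) = s(x, x + 1)} := by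
    ext ω
    simp only [Set.mem_ofPred_eq, frequently_atTop, Set.mem_iInter, Set.mem_iUnion,
      Set.mem_preimage, exists_prop]
  rw [h]
  exact MeasurableSet.iInter fun a => MeasurableSet.iUnion fun n => MeasurableSet.iUnion fun _ =>
    ((hX n).prodMk (hX (n + 1))) MeasurableSet.of_discrete

variable [IsProbabilityMeasure μ]

/-- Almost surely, the walk does not traverse two given adjacent edges infinitely often, if the
reciprocal weights of both edges are summable. -/
lemma IsERRW.ae_not_frequently_adjacent (hf : IsReinforcementScheme f) (hX : IsERRW μ f X)
    (hsum : ∀ x, Summable fun k => (f k x)⁻¹) (x : ℕ) :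
    ∀ᵐ ω ∂μ, ¬ ((∃ᶠ n in atTop, s(X n ω, X (n + 1) ω) = s(x, x + 1)) ∧
      ∃ᶠ n in atTop, s(X n ω, X (n + 1) ω) = s(x + 1, x + 1 + 1)) := by
  set A := {ω | ∃ᶠ n in atTop, s(X n ω, X (n + 1) ω) = s(x, x + 1)} with hAdef
  set B := {ω | ∃ᶠ n in atTop, s(X n ω, X (n + 1) ω) = s(x + 1, x + 1 + 1)} with hBdef
  have hA : MeasurableSet A := measurableSet_frequently_edge hX.measurable x
  have hB : MeasurableSet B := measurableSet_frequently_edge hX.measurable (x + 1)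
  -- The parities depend on the starting point, so it is fixed first.
  suffices hnull : ∀ y, μ ({ω | X 0 ω = y} ∩ (A ∩ B)) = 0 by
    filter_upwards [ae_all_iff.mpr fun y => measure_eq_zero_iff_ae_notMem.mp (hnull y)] with ω hω h
    exact hω (X 0 ω) ⟨rfl, h⟩
  intro y
  have hD : MeasurableSet ({ω | X 0 ω = y} ∩ (A ∩ B)) :=
    (measurableSet_right hX.measurable 0 y).inter (hA.inter hB)
  have hεL : leftParity y x < 2 := by unfold leftParity; split_ifs <;> omega
  have hεR : rightParity y (x + 1) < 2 := by unfold rightParity; split_ifs <;> omega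
  have hpos := fun x k => hf.pos k x
  have ht : ∀ N : ℕ, |((N : ℝ) + 1)| = N + 1 := fun N => abs_of_pos (by positivity)
  have ht' : ∀ N : ℕ, |(-((N : ℝ) + 1))| = N + 1 := fun N => by rw [abs_neg, ht]
  choose wL hwL hwL1 hwL0 using fun ω =>
    exists_limit_phaseRatio (hpos x) (hsum x) hεL ht' (fun i => X i ω) x
  choose wR hwR hwR1 hwR0 using fun ω =>
    exists_limit_phaseRatio (hpos (x + 1)) (hsum (x + 1)) hεR ht (fun i => X i ω) (x + 1)
  have hbound : ∀ t a m m', ‖phaseFunction f x y t a m m'‖ ≤ 1 := by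
    intro t a m m'
    unfold phaseFunction
    split_ifs
    · rw [norm_mul]
      exact mul_le_one₀ (norm_phaseRatio_le_one (hpos x) (hsum x) _ _ _) (norm_nonneg _)
        (norm_phaseRatio_le_one (hpos (x + 1)) (hsum (x + 1)) _ _ _)
    · simp
  have hint := fun t n => integrable_of_traversals (μ := μ) hX.measurable (phaseFunction f x y t)
    (hbound t) n x (x + 1)
  set W : ℕ → Ω → ℂ := fun N ω => if X 0 ω = y then wL ω N * wR ω N else 0 with hW
  have hlim : ∀ N : ℕ, ∀ ω, Tendsto (fun n => phaseFunction f x y (N + 1) (X 0 ω)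
      (traversals (fun i => X i ω) n x) (traversals (fun i => X i ω) n (x + 1))) atTop
      (nhds (W N ω)) := by
    intro N ω
    simp only [hW, phaseFunction]
    split_ifs
    · exact (hwL ω N).mul (hwR ω N)
    · exact tendsto_const_nhds
  have hWbound : ∀ N ω, ‖W N ω‖ ≤ 1 := fun N ω =>
    le_of_tendsto (hlim N ω).norm (Eventually.of_forall fun n => hbound _ _ _ _)
  have hWmeas : ∀ N, AEStronglyMeasurable (W N) μ := fun N =>
    aestronglyMeasurable_of_tendsto_ae atTop (fun n => (hint _ n).aestronglyMeasurable)
      (Eventually.of_forall (hlim N))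
  -- Constant expectation passes to the limit in time, the martingale being bounded by one.
  have hWint : ∀ N : ℕ, ∫ ω, W N ω ∂μ = ∫ ω, phaseFunction f x y (N + 1) (X 0 ω) 0 0 ∂μ := by
    intro N
    have h1 := tendsto_integral_of_dominated_convergence (fun _ => (1 : ℝ))
      (fun n => (hint (N + 1) n).aestronglyMeasurable) (integrable_const _)
      (fun n => Eventually.of_forall fun ω => hbound _ _ _ _) (Eventually.of_forall (hlim N))
    have h2 := hX.integral_eq_integral_zero
      (fun n p => phaseFunction f x y (N + 1) (p 0) (traversals p n x) (traversals p n (x + 1)))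
      (fun n q q' hq => by
        rw [hq 0 (Nat.zero_le n), traversals_congr hq, traversals_congr hq])
      (hint (N + 1)) (phaseFunction_step hf x y (N + 1))
    simp only [traversals_zero] at h2
    simp only [h2] at h1
    exact tendsto_nhds_unique h1 tendsto_const_nhds
  have hW0 : Tendsto (fun N => ∫ ω, W N ω ∂μ) atTop (nhds 0) := by
    have hz := (tendsto_phaseRatio_zero (hpos x) (hsum x) hεL ht' 0).norm
    rw [norm_zero] at hz
    refine squeeze_zero_norm (fun N => ?_) hz
    rw [hWint N]
    refine (norm_integral_le_of_norm_le_const (C := ‖phaseRatio (fun k => f k x) (leftParity y x)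
      (-((N : ℝ) + 1)) 0‖) (Eventually.of_forall fun ω => ?_)).trans (by simp)
    unfold phaseFunction
    split_ifs
    · rw [norm_mul]
      exact mul_le_of_le_one_right (norm_nonneg _)
        (norm_phaseRatio_le_one (hpos (x + 1)) (hsum (x + 1)) _ _ _)
    · simp
  -- As the frequency grows, an edge crossed finitely often contributes a factor tending to `0`, one
  -- crossed infinitely often a factor `1`.
  have hWlim : ∀ ω, Tendsto (fun N => W N ω) atTop
      (nhds (({ω | X 0 ω = y} ∩ (A ∩ B)).indicator (fun _ => (1 : ℂ)) ω)) := by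
    intro ω
    simp only [hW]
    by_cases h0 : X 0 ω = y
    · simp only [h0, if_true]
      by_cases ha : ω ∈ A
      · by_cases hb : ω ∈ B
        · rw [Set.indicator_of_mem (show ω ∈ {ω | X 0 ω = y} ∩ (A ∩ B) from ⟨h0, ha, hb⟩)]
          simpa using (hwL1 ω ha).mul (hwR1 ω hb)
        · rw [Set.indicator_of_notMem fun h => hb h.2.2]
          simpa using (hwL1 ω ha).mul (hwR0 ω hb)
      · rw [Set.indicator_of_notMem fun h => ha h.2.1]
        by_cases hb : ω ∈ B
        · simpa using (hwL0 ω ha).mul (hwR1 ω hb)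
        · simpa using (hwL0 ω ha).mul (hwR0 ω hb)
    · rw [Set.indicator_of_notMem fun h => h0 h.1]
      simp only [h0, if_false]
      exact tendsto_const_nhds
  have h3 := tendsto_integral_of_dominated_convergence (fun _ => (1 : ℝ)) hWmeas
    (integrable_const _) (fun N => Eventually.of_forall (hWbound N)) (Eventually.of_forall hWlim)
  have h4 := tendsto_nhds_unique h3 hW0
  rw [integral_indicator_const _ hD, Complex.real_smul, mul_one] at h4
  exact (measureReal_eq_zero_iff).mp (by exact_mod_cast h4)

end AdjacentEdges

end ERRW

/-! ### Conclusion -/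

theorem proposition3p3 {Ω : Type*} [MeasurableSpace Ω] (μ : Measure Ω) [IsProbabilityMeasure μ]
    (f : ℕ → ℕ → ℝ) (δ : ℕ → ℝ) (X : ℕ → Ω → ℕ)
    (hf : ERRW.IsReinforcementScheme f) (hX : ERRW.IsERRW μ f X) (hδ : ERRW.IsFTR f δ)
    (C : ℝ) (hC : 0 < C) (hfC : ∀ x : ℕ, f 0 (x + 1) / f 0 x ≤ C)
    (hsum : Summable fun ℓ => (δ ℓ)⁻¹) :
    ∀ᵐ ω ∂μ, ERRW.LocalizesOnSingleEdge (fun n => X n ω) := by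
  have hsum' : ∀ x, Summable fun k => (f k x)⁻¹ := fun x => by
    refine (hsum.mul_right (f 0 x)⁻¹).congr fun k => ?_
    rw [hδ.factor k x, mul_inv]
  filter_upwards [hX.ae_isNearestNeighbour, hX.ae_exists_traversals_eq_zero hf hδ hC hfC hsum,
    ae_all_iff.mpr (hX.ae_not_frequently_adjacent hf hsum')] with ω hnn hbdd hadj
  obtain ⟨z, hz0, hz⟩ := hbdd
  exact ERRW.localizesOnSingleEdge_of_bounded hnn
    (fun n => ERRW.le_of_traversals_eq_zero (hnn n) hz0 (hz n)) hadj
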